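/- Let $R$ be a commutative Noetherian local ring. A pointed étale neighborhood of $R$ is a local homomorphism $R\to S$ of local rings that is étale and essentially of finite type and induces an isomorphism on residue fields; the Henselization $R^{\mathrm h}$ of $R$ is the direct limit of the pointed étale neighborhoods of $R$ along the local $R$-algebra homomorphisms between them. Let $M$ be a finitely generated $R$-module. The following conditions are equivalent. 1. $M$ admits an $R^{\mathrm h}$-module structure that is compatible with its $R$-module structure, i.e. the image in $R^{\mathrm h}$ of each $r\in R$ acts on $M$ as $r$ does. 2. For each $P\in\operatorname{Supp}_R(M)$, the ring $R/P$ is Henselian. 3. For each minimal element $P$ of $\operatorname{Supp}_R(M)$, the ring $R/P$ is Henselian. If moreover $M\neq 0$, these conditions are also equivalent to the following one. 4. The ring $R/\operatorname{Ann}_R(M)$ is Henselian. -/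

import Mathlib

universe u v

/-- A pointed étale neighborhood of a local ring `R`: a local `R`-algebra `S` such that `R → S` is
a local homomorphism, étale and essentially of finite type, and induces an isomorphism of residue
fields. -/
structure PointedEtaleNeighborhood (R : Type u) [CommRing R] [IsLocalRing R] where
  carrier : Type u
  [commRing : CommRing carrier]
  [isLocalRing : IsLocalRing carrier]
  [algebra : Algebra R carrier]
  [isLocalHom : IsLocalHom (algebraMap R carrier)]
  [formallyEtale : Algebra.FormallyEtale R carrier]
  [essFiniteType : Algebra.EssFiniteType R carrier]
  residue_bijective :
    Function.Bijective (IsLocalRing.ResidueField.map (algebraMap R carrier))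

namespace PointedEtaleNeighborhood

attribute [instance] commRing isLocalRing algebra isLocalHom formallyEtale essFiniteType

variable {R : Type u} [CommRing R] [IsLocalRing R]

/-- `A ≤ B` if there is a local homomorphism of `R`-algebras `A → B`. -/
instance : Preorder (PointedEtaleNeighborhood R) where
  le A B := ∃ f : A.carrier →ₐ[R] B.carrier, IsLocalHom f.toRingHom
  le_refl A := ⟨AlgHom.id R A.carrier, ⟨fun _ h => h⟩⟩
  le_trans A B C := by
    rintro ⟨f, hf⟩ ⟨g, hg⟩
    exact ⟨g.comp f, ⟨fun a h => hf.map_nonunit a (hg.map_nonunit (f a) h)⟩⟩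

/-- The transition map of the direct system (it is unique, see `algHom_unique`). -/
noncomputable def transition (A B : PointedEtaleNeighborhood R) (h : A ≤ B) :
    A.carrier →ₐ[R] B.carrier :=
  h.choose

/-- There is at most one local homomorphism of `R`-algebras between two pointed étale
neighborhoods of a Noetherian local ring, so these form a direct system. -/
theorem algHom_unique [IsNoetherianRing R] (A B : PointedEtaleNeighborhood R)
    (f g : A.carrier →ₐ[R] B.carrier) (hf : IsLocalHom f.toRingHom)
    (hg : IsLocalHom g.toRingHom) : f = g := by
  have : IsNoetherianRing B.carrier := Algebra.EssFiniteType.isNoetherianRing R B.carrier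
  refine Algebra.FormallyUnramified.ext_of_iInf (I := IsLocalRing.maximalIdeal B.carrier)
    (Ideal.iInf_pow_eq_bot_of_isLocalRing _ Ideal.IsPrime.ne_top') fun x => ?_
  obtain ⟨y, hy⟩ := A.residue_bijective.2 (IsLocalRing.residue A.carrier x)
  obtain ⟨r, rfl⟩ := IsLocalRing.residue_surjective y
  rw [IsLocalRing.ResidueField.map_residue, ← sub_eq_zero, ← map_sub,
    IsLocalRing.residue_eq_zero_iff] at hy
  have key : ∀ k : A.carrier →ₐ[R] B.carrier, IsLocalHom k.toRingHom →
      algebraMap R B.carrier r - k x ∈ IsLocalRing.maximalIdeal B.carrier := by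
    intro k hk
    have : algebraMap R B.carrier r - k x = k.toRingHom (algebraMap R A.carrier r - x) := by simp
    rw [this]
    intro hu
    exact hy (hk.map_nonunit _ hu)
  rw [Ideal.Quotient.eq]
  have := Ideal.sub_mem _ (key g hg) (key f hf)
  simpa using this

/-- `R` as a pointed étale neighborhood of itself. -/
noncomputable def self (R : Type u) [CommRing R] [IsLocalRing R] : PointedEtaleNeighborhood R where
  carrier := R
  isLocalHom := ⟨fun _ h => h⟩
  residue_bijective := by
    have h : Function.Bijective (IsLocalRing.ResidueField.map (RingHom.id R)) := by
      rw [IsLocalRing.ResidueField.map_id]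
      exact Function.bijective_id
    exact h

end PointedEtaleNeighborhood

/-- The Henselization of a local ring: the direct limit of its pointed étale neighborhoods. -/
def Henselization (R : Type u) [CommRing R] [IsLocalRing R] : Type (u + 1) :=
  Ring.DirectLimit (fun A : PointedEtaleNeighborhood R => A.carrier)
    (fun A B h => A.transition B h)

namespace Henselization

variable (R : Type u) [CommRing R] [IsLocalRing R]

noncomputable instance : CommRing (Henselization R) :=
  inferInstanceAs (CommRing (Ring.DirectLimit (fun A : PointedEtaleNeighborhood R => A.carrier)
    (fun A B h => A.transition B h)))

/-- The canonical map from a pointed étale neighborhood to the Henselization. -/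
noncomputable def of (A : PointedEtaleNeighborhood R) : A.carrier →+* Henselization R :=
  Ring.DirectLimit.of (fun A : PointedEtaleNeighborhood R => A.carrier)
    (fun A B h => A.transition B h) A

/-- The natural homomorphism from `R` to its Henselization. -/
noncomputable instance : Algebra R (Henselization R) :=
  RingHom.toAlgebra (of R (PointedEtaleNeighborhood.self R))

end Henselization

/-- `M` has an `S`-module structure compatible with its `R`-module structure. -/
def HasCompatibleModuleStructure (R : Type*) (S : Type*) (M : Type*) [CommRing R] [CommRing S]
    [Algebra R S] [AddCommGroup M] [Module R M] : Prop :=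
  ∃ _ : Module S M, ∀ (r : R) (x : M), algebraMap R S r • x = r • x

/-!
For `M = 0` all conditions of the list hold. For `M ≠ 0`, everything is compared with the condition
that `R ⧸ Ann(M)` is Henselian.

*Support conditions.* For an ideal `I` of `R`, let `HenselModulo I` be Hensel's lemma for `R ⧸ I`,
stated with elements of `R`. It passes to larger ideals, so it holds at all primes in the support
when it holds at `Ann(M)`. Conversely it passes from finitely many ideals to their intersection,
since simple roots lift uniquely and hence glue (`HenselModulo.inf`), and from the radical of an
ideal to the ideal, by Newton's method for nilpotents (`HenselModulo.of_radical`). So it holds at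
`Ann(M)` as soon as it holds at the minimal primes over `Ann(M)`
(`HenselModulo.of_minimalPrimes`), which are the minimal elements of the support.

*From `R ⧸ Ann(M)` Henselian to a module structure.* Every pointed étale neighborhood of `R` is,
near its closed point, standard étale, and hence has an `R`-algebra map to any Henselian local ring
over which `R` is local (`PointedEtaleNeighborhood.exists_algHom_of_henselianLocalRing`). For
Noetherian targets this map is unique, so these maps define a map from the Henselization to
`R ⧸ Ann(M)`, which acts on `M`.

*From a module structure to `R ⧸ Ann(M)` Henselian.* A simple root modulo the maximal ideal lifts to
a root `x` in a pointed étale neighborhood (`PointedEtaleNeighborhood.exists_root`), which acts on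
`M` through the Henselization. By Nakayama's lemma in `End_R(M)`, `x` acts as an element of `R`
(`PointedEtaleNeighborhood.exists_smul_eq`), and this element is a root modulo `Ann(M)`.
-/

open Polynomial

/-! ### Hensel's lemma modulo an ideal -/

section HenselianQuotients

open IsLocalRing

variable {R : Type*} [CommRing R] [IsLocalRing R]

/-- Hensel's lemma holds for the quotient `R ⧸ I` of a local ring, expressed by elements of `R`:
an approximate simple root modulo the maximal ideal of a monic polynomial over `R` can be corrected
to a root modulo `I`. For a proper ideal `I` this says that `R ⧸ I` is Henselian; the unit ideal
satisfies it trivially. -/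
def HenselModulo (I : Ideal R) : Prop :=
  ∀ f : R[X], f.Monic → ∀ a₀ : R, f.eval a₀ ∈ maximalIdeal R → IsUnit (f.derivative.eval a₀) →
    ∃ a, f.eval a ∈ I ∧ a - a₀ ∈ maximalIdeal R

lemma IsLocalRing.isUnit_iff_of_sub_mem {a b : R} (h : a - b ∈ maximalIdeal R) :
    IsUnit a ↔ IsUnit b := by
  rw [← not_iff_not, ← mem_nonunits_iff, ← mem_nonunits_iff, ← mem_maximalIdeal, ← mem_maximalIdeal]
  exact ⟨fun ha => by simpa using sub_mem ha h, fun hb => by simpa using add_mem h hb⟩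

lemma Polynomial.eval_sub_eval_mem {A : Type*} [CommRing A] {I : Ideal A} (f : A[X]) {a b : A}
    (h : a - b ∈ I) : f.eval a - f.eval b ∈ I :=
  I.mem_of_dvd (sub_dvd_eval_sub a b f) h

lemma IsLocalRing.isUnit_quotient_mk_iff {I : Ideal R} (hI : I ≤ maximalIdeal R) {a : R} :
    IsUnit (Ideal.Quotient.mk I a) ↔ IsUnit a := by
  have := isLocalHom_of_le_jacobson_bot I
    (hI.trans (maximalIdeal_le_jacobson _))
  exact isUnit_map_iff _ _

lemma IsLocalRing.isLocalRing_quotient {I : Ideal R} (hI : I ≤ maximalIdeal R) :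
    IsLocalRing (R ⧸ I) :=
  have := Ideal.Quotient.nontrivial_iff.mpr (ne_top_of_le_ne_top Ideal.IsPrime.ne_top' hI)
  .of_surjective' _ Ideal.Quotient.mk_surjective

lemma henselianLocalRing_quotient_iff {I : Ideal R} (hI : I ≤ maximalIdeal R) :
    HenselianLocalRing (R ⧸ I) ↔ HenselModulo I := by
  have := isLocalRing_quotient hI
  have hmem (a : R) : Ideal.Quotient.mk I a ∈ maximalIdeal (R ⧸ I) ↔ a ∈ maximalIdeal R := by
    simp only [mem_maximalIdeal, mem_nonunits_iff, isUnit_quotient_mk_iff hI]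
  constructor
  · intro h f hf a₀ h₁ h₂
    obtain ⟨a, ha, ha'⟩ := h.is_henselian (f.map (Ideal.Quotient.mk I)) (hf.map _)
      (Ideal.Quotient.mk I a₀) (by rwa [eval_map_apply, hmem])
      (by rw [derivative_map, eval_map_apply]; exact h₂.map _)
    obtain ⟨a, rfl⟩ := Ideal.Quotient.mk_surjective a
    refine ⟨a, ?_, ?_⟩
    · rwa [IsRoot, eval_map_apply, Ideal.Quotient.eq_zero_iff_mem] at ha
    · rwa [← map_sub, hmem] at ha'
  · intro h
    refine ⟨fun f hf a₀ h₁ h₂ => ?_⟩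
    obtain ⟨a₀, rfl⟩ := Ideal.Quotient.mk_surjective a₀
    obtain ⟨g, rfl, -, hg⟩ := lifts_and_natDegree_eq_and_monic
      (f := Ideal.Quotient.mk I) (map_surjective _ Ideal.Quotient.mk_surjective f) hf
    rw [eval_map_apply, hmem] at h₁
    rw [derivative_map, eval_map_apply, isUnit_quotient_mk_iff hI] at h₂
    obtain ⟨a, ha, ha'⟩ := h g hg a₀ h₁ h₂
    refine ⟨Ideal.Quotient.mk I a, ?_, ?_⟩
    · rwa [IsRoot, eval_map_apply, Ideal.Quotient.eq_zero_iff_mem]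
    · rwa [← map_sub, hmem]

namespace HenselModulo

lemma mono {I J : Ideal R} (h : HenselModulo I) (hIJ : I ≤ J) : HenselModulo J := by
  intro f hf a₀ h₁ h₂
  obtain ⟨a, ha, ha'⟩ := h f hf a₀ h₁ h₂
  exact ⟨a, hIJ ha, ha'⟩

lemma maximalIdeal : HenselModulo (maximalIdeal R) :=
  fun _ _ a₀ h₁ _ => ⟨a₀, h₁, by simp⟩

/-- `R ⧸ (I ⊓ J)` is the fibre product of `R ⧸ I` and `R ⧸ J` over `R ⧸ (I ⊔ J)`. The roots over
`R ⧸ I` and `R ⧸ J` agree over `R ⧸ (I ⊔ J)`, because simple roots lift uniquely to a local ring,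
and so they glue. -/
lemma inf {I J : Ideal R} (hI : I ≤ IsLocalRing.maximalIdeal R) (h : HenselModulo I)
    (h' : HenselModulo J) : HenselModulo (I ⊓ J) := by
  intro f hf a₀ h₁ h₂
  obtain ⟨a, ha, ha₀⟩ := h f hf a₀ h₁ h₂
  obtain ⟨b, hb, hb₀⟩ := h' f hf a₀ h₁ h₂
  have hba : b - a ∈ IsLocalRing.maximalIdeal R := by simpa using sub_mem hb₀ ha₀
  obtain ⟨c, hc⟩ := exists_mul_sq_add_linear_part_eq_eval_add f a (b - a)
  have hu : IsUnit (f.derivative.eval a + c * (b - a)) := by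
    refine (isUnit_iff_of_sub_mem ?_).mpr h₂
    rw [add_sub_right_comm]
    exact add_mem (eval_sub_eval_mem _ ha₀) (Ideal.mul_mem_left _ _ hba)
  have hmem : b - a ∈ I ⊔ J := by
    rw [← Ideal.unit_mul_mem_iff_mem _ hu]
    have : (f.derivative.eval a + c * (b - a)) * (b - a) = - f.eval a + f.eval b := by
      rw [add_sub_cancel] at hc
      linear_combination hc
    rw [this]
    exact Submodule.add_mem_sup (neg_mem ha) hb
  obtain ⟨i, hi, j, hj, hij⟩ := Submodule.mem_sup.mp hmem
  refine ⟨a + i, ⟨?_, ?_⟩, ?_⟩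
  · simpa using add_mem (f.eval_sub_eval_mem (a := a + i) (b := a) (I := I) (by simpa)) ha
  · refine (Submodule.sub_mem_iff_left J hb).mp (f.eval_sub_eval_mem ?_)
    have : a + i - b = -j := by linear_combination hij
    rw [this]
    exact neg_mem hj
  · rw [add_sub_right_comm]
    exact add_mem ha₀ (hI hi)

lemma of_radical {I : Ideal R} (hI : I ≤ IsLocalRing.maximalIdeal R) (h : HenselModulo I.radical) :
    HenselModulo I := by
  intro f hf a₀ h₁ h₂
  obtain ⟨a, ha, ha₀⟩ := h f hf a₀ h₁ h₂
  have hnil (x : R) : IsNilpotent (Ideal.Quotient.mk I x) ↔ x ∈ I.radical := by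
    simp only [IsNilpotent, ← map_pow, Ideal.Quotient.eq_zero_iff_mem]; rfl
  have haeval (g : R[X]) (x : R) :
      aeval (Ideal.Quotient.mk I x) g = Ideal.Quotient.mk I (g.eval x) := by
    rw [← Ideal.Quotient.algebraMap_eq, aeval_algebraMap_apply_eq_algebraMap_eval]
  obtain ⟨r, ⟨hr, hr'⟩, -⟩ := existsUnique_nilpotent_sub_and_aeval_eq_zero (P := f)
    (x := Ideal.Quotient.mk I a) (by rwa [haeval, hnil])
    (by rw [haeval]
        exact ((isUnit_iff_of_sub_mem (eval_sub_eval_mem _ ha₀)).mpr h₂).map _)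
  obtain ⟨b, rfl⟩ := Ideal.Quotient.mk_surjective r
  rw [haeval, Ideal.Quotient.eq_zero_iff_mem] at hr'
  rw [← map_sub, hnil] at hr
  refine ⟨b, hr', ?_⟩
  simpa using sub_mem ha₀ ((Ideal.IsPrime.radical_le_iff inferInstance).mpr hI hr)

/-- Over a Noetherian ring the Hensel property modulo `I` can be tested at the finitely many minimal
primes of `I`, whose intersection is the radical of `I`. -/
lemma of_minimalPrimes [IsNoetherianRing R] {I : Ideal R} (hI : I ≤ IsLocalRing.maximalIdeal R)
    (h : ∀ P ∈ I.minimalPrimes, HenselModulo P) : HenselModulo I := by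
  refine of_radical hI ?_
  have key : ∀ s : Finset (Ideal R), (∀ P ∈ s, HenselModulo P) →
      HenselModulo (IsLocalRing.maximalIdeal R ⊓ s.inf id) := by
    classical
    intro s
    induction s using Finset.induction_on with
    | empty => simpa using maximalIdeal
    | insert P s _ ih =>
      intro hs
      have := inf inf_le_left (ih fun Q hQ => hs Q (Finset.mem_insert_of_mem hQ))
        (hs P (Finset.mem_insert_self _ _))
      rwa [inf_assoc, inf_comm _ P, ← id_eq P, ← Finset.inf_insert] at this
  have hfin := I.finite_minimalPrimes_of_isNoetherianRing
  refine (key hfin.toFinset (by simpa using h)).mono ?_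
  rw [← I.sInf_minimalPrimes]
  refine inf_le_right.trans (le_sInf fun P hP => ?_)
  exact Finset.inf_le (f := id) (hfin.mem_toFinset.mpr hP)

end HenselModulo

end HenselianQuotients

/-! ### Maps out of pointed étale neighborhoods and their construction -/

namespace PointedEtaleNeighborhood

open IsLocalRing

variable {R : Type u} [CommRing R] [IsLocalRing R]

lemma exists_algebraMap_sub_mem (A : PointedEtaleNeighborhood R) (x : A.carrier) :
    ∃ r : R, x - algebraMap R A.carrier r ∈ maximalIdeal A.carrier := by
  obtain ⟨y, hy⟩ := A.residue_bijective.2 (residue A.carrier x)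
  obtain ⟨r, rfl⟩ := residue_surjective y
  refine ⟨r, ?_⟩
  rw [← residue_eq_zero_iff, map_sub, sub_eq_zero, ← hy, ResidueField.map_residue]

section Uniqueness

variable (A : PointedEtaleNeighborhood R) {H : Type*} [CommRing H] [IsLocalRing H] [Algebra R H]
  [IsLocalHom (algebraMap R H)]

/-- The maximal ideal of a pointed étale neighborhood is generated by that of `R`, so every
`R`-algebra homomorphism to a local ring over which `R` is local respects the maximal ideals. -/
lemma map_mem_maximalIdeal (φ : A.carrier →ₐ[R] H) {x : A.carrier}
    (hx : x ∈ maximalIdeal A.carrier) : φ x ∈ maximalIdeal H := by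
  rw [← Algebra.FormallyUnramified.map_maximalIdeal (R := R) (S := A.carrier)] at hx
  suffices h : (maximalIdeal R).map (algebraMap R A.carrier) ≤
      (maximalIdeal H).comap φ from h hx
  refine Ideal.map_le_iff_le_comap.mpr fun r hr => ?_
  simpa using hr

lemma algHom_ext_of_isNoetherianRing [IsNoetherianRing H] (φ ψ : A.carrier →ₐ[R] H) : φ = ψ := by
  refine Algebra.FormallyUnramified.ext_of_iInf (I := maximalIdeal H)
    (Ideal.iInf_pow_eq_bot_of_isLocalRing _ Ideal.IsPrime.ne_top') fun x => ?_
  obtain ⟨r, hr⟩ := A.exists_algebraMap_sub_mem x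
  rw [Ideal.Quotient.eq]
  simpa using sub_mem (A.map_mem_maximalIdeal φ hr) (A.map_mem_maximalIdeal ψ hr)

end Uniqueness

/-- The composite of the residue map of a pointed étale neighborhood with the inverse of the
isomorphism of residue fields and the map induced by `R → H`. -/
lemma exists_algHom_residueField (A : PointedEtaleNeighborhood R) (H : Type*) [CommRing H]
    [IsLocalRing H] [Algebra R H] [IsLocalHom (algebraMap R H)] :
    ∃ θ : A.carrier →ₐ[R] ResidueField H, ∀ x, θ x = 0 ↔ x ∈ maximalIdeal A.carrier := by
  let e := RingEquiv.ofBijective _ A.residue_bijective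
  refine ⟨{ toRingHom := ((ResidueField.map (algebraMap R H)).comp e.symm.toRingHom).comp
              (residue A.carrier)
            commutes' := fun r => ?_ }, fun x => ?_⟩
  · have : e.symm (residue A.carrier (algebraMap R A.carrier r)) = residue R r := by
      rw [RingEquiv.symm_apply_eq]
      exact (ResidueField.map_residue _ r).symm
    change ResidueField.map _ (e.symm _) = _
    rw [this, ResidueField.map_residue]
    rfl
  · change ResidueField.map _ (e.symm _) = 0 ↔ _
    rw [map_eq_zero, map_eq_zero_iff _ e.symm.injective, residue_eq_zero_iff]

/-- A pointed étale neighborhood is a localization of a finite type algebra at a prime at which that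
algebra is étale. Near this prime the algebra is standard étale, hence maps out of it amount to
simple roots of a polynomial, which a Henselian local ring provides. The root is chosen to have the
residue class prescribed by the neighborhood, so that everything outside the prime becomes
invertible. -/
theorem exists_algHom_of_henselianLocalRing [IsNoetherianRing R] (A : PointedEtaleNeighborhood R)
    (H : Type*) [CommRing H] [HenselianLocalRing H] [Algebra R H] [IsLocalHom (algebraMap R H)] :
    Nonempty (A.carrier →ₐ[R] H) := by
  let B := Algebra.EssFiniteType.subalgebra R A.carrier
  let q : Ideal B := (maximalIdeal A.carrier).comap (algebraMap B A.carrier)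
  have hq : Algebra.EssFiniteType.submonoid R A.carrier = q.primeCompl := by
    ext b
    simp [q, Algebra.EssFiniteType.submonoid, Ideal.primeCompl, IsUnit.mem_submonoid_iff, B]
  have hloc : IsLocalization q.primeCompl A.carrier :=
    hq ▸ Algebra.EssFiniteType.isLocalization R A.carrier
  have : Algebra.FinitePresentation R B := Algebra.FinitePresentation.of_finiteType.mp inferInstance
  have : Algebra.IsEtaleAt R q := Algebra.FormallyEtale.of_equiv
    ((IsLocalization.algEquiv q.primeCompl A.carrier (Localization.AtPrime q)).restrictScalars R)
  obtain ⟨s, hs, ⟨⟨E⟩⟩⟩ := Algebra.IsEtaleAt.exists_isStandardEtale (R := R) q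
  have hsu : IsUnit (algebraMap B A.carrier s) :=
    IsLocalization.map_units A.carrier (⟨s, hs⟩ : q.primeCompl)
  let ψ : Localization.Away s →ₐ[R] A.carrier :=
    IsLocalization.Away.liftAlgHom s (f := IsScalarTower.toAlgHom R B A.carrier) hsu
  have hψ (b : B) : ψ (algebraMap B _ b) = algebraMap B A.carrier b :=
    IsLocalization.Away.lift_eq s hsu b
  have hy := E.hasMap.map ψ
  -- `r` approximates the generator, and Hensel's lemma turns it into an exact root in `H`.
  obtain ⟨r, hr⟩ := A.exists_algebraMap_sub_mem (ψ E.x)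
  have heval (p : R[X]) : aeval (ψ E.x) p - algebraMap R A.carrier (p.eval r) ∈
      maximalIdeal A.carrier := by
    rw [← aeval_algebraMap_apply_eq_algebraMap_eval, ← eval_map_algebraMap, ← eval_map_algebraMap]
    exact eval_sub_eval_mem _ hr
  have hunit (p : R[X]) (hp : IsUnit (aeval (ψ E.x) p)) : IsUnit (p.eval r) := by
    rw [isUnit_iff_of_sub_mem (heval p)] at hp
    exact isUnit_of_map_unit _ _ hp
  have hfr : E.f.eval r ∈ maximalIdeal R := by
    have := heval E.f
    rw [hy.1, zero_sub, neg_mem_iff] at this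
    simpa using this
  obtain ⟨a, ha, har⟩ := HenselianLocalRing.is_henselian (E.f.map (algebraMap R H))
    (E.monic_f.map _) (algebraMap R H r)
    (by rw [eval_map_apply]; simpa using hfr)
    (by rw [derivative_map, eval_map_apply]; exact (hunit _ hy.isUnit_derivative_f).map _)
  have hmap : E.HasMap a := by
    refine ⟨by rwa [IsRoot, eval_map_algebraMap] at ha, ?_⟩
    rw [← eval_map_algebraMap, isUnit_iff_of_sub_mem (eval_sub_eval_mem _ har), eval_map_apply]
    exact (hunit _ hy.2).map _
  let χ : Localization.Away s →ₐ[R] H := (E.lift a hmap).comp E.equivRing.toAlgHom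
  have hχ : χ E.x = a := by simp [χ]
  obtain ⟨θ, hθ⟩ := A.exists_algHom_residueField H
  -- Both maps to the residue field of `H` send the generator to the class of `r`.
  have hcomp : (IsScalarTower.toAlgHom R H (ResidueField H)).comp χ = θ.comp ψ := by
    refine E.hom_ext ?_
    have h₁ : residue H a = residue H (algebraMap R H r) := by
      rwa [← sub_eq_zero, ← map_sub, residue_eq_zero_iff]
    have h₂ : θ (ψ E.x) = θ (algebraMap R A.carrier r) := by
      rwa [← sub_eq_zero, ← map_sub, hθ]
    change residue H (χ E.x) = θ (ψ E.x)
    rw [hχ, h₁, h₂, AlgHom.commutes]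
    rfl
  refine ⟨IsLocalization.liftAlgHom (M := q.primeCompl)
    (f := χ.comp (IsScalarTower.toAlgHom R B (Localization.Away s))) fun b => ?_⟩
  have h : residue H (χ (algebraMap B _ b.1)) = θ (algebraMap B A.carrier b.1) :=
    (DFunLike.congr_fun hcomp _).trans (congrArg θ (hψ _))
  change IsUnit (χ (algebraMap B _ b.1))
  rw [← residue_ne_zero_iff_isUnit, h, Ne, hθ]
  exact b.2

/-- A simple root `a₀` of `f` modulo the maximal ideal lifts to a root in a pointed étale
neighborhood: localize the standard étale algebra `R[X][1/f']/(f)` at the kernel of its map to the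
residue field of `R` that sends `X` to the class of `a₀`. -/
theorem exists_root {f : R[X]} (hf : f.Monic) {a₀ : R} (h₁ : f.eval a₀ ∈ maximalIdeal R)
    (h₂ : IsUnit (f.derivative.eval a₀)) :
    ∃ (A : PointedEtaleNeighborhood R) (x : A.carrier),
      aeval x f = 0 ∧ x - algebraMap R A.carrier a₀ ∈ maximalIdeal A.carrier := by
  let P : StandardEtalePair R := ⟨f, hf, f.derivative, 1, 0, 1, by simp⟩
  have haeval (g : R[X]) : aeval (residue R a₀) g = residue R (g.eval a₀) :=
    aeval_algebraMap_apply_eq_algebraMap_eval a₀ g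
  have hP : P.HasMap (residue R a₀) := by
    refine ⟨?_, ?_⟩
    · rw [haeval, residue_eq_zero_iff]
      exact h₁
    · rw [haeval]
      exact h₂.map _
  let ε : P.Ring →ₐ[R] ResidueField R := P.lift _ hP
  have hε : Function.Surjective ε := fun y => by
    obtain ⟨r, rfl⟩ := residue_surjective y
    exact ⟨algebraMap R P.Ring r, by rw [AlgHom.commutes]; rfl⟩
  let q : Ideal P.Ring := RingHom.ker ε
  have hq : q.IsMaximal := RingHom.ker_isMaximal_of_surjective ε hε
  have hmem (y : P.Ring) : algebraMap P.Ring (Localization.AtPrime q) y ∈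
      maximalIdeal (Localization.AtPrime q) ↔ ε y = 0 := by
    rw [IsLocalization.AtPrime.to_map_mem_maximal_iff _ q]; rfl
  have hlocal : IsLocalHom (algebraMap R (Localization.AtPrime q)) := by
    refine ⟨fun r hr => ?_⟩
    contrapose! hr
    rw [IsScalarTower.algebraMap_apply R P.Ring, ← mem_nonunits_iff, ← mem_maximalIdeal, hmem,
      AlgHom.commutes]
    exact (residue_eq_zero_iff r).mpr hr
  refine ⟨{ carrier := Localization.AtPrime q
            residue_bijective := ⟨RingHom.injective _, fun y => ?_⟩ },
    algebraMap P.Ring _ P.X, ?_, ?_⟩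
  · obtain ⟨e, rfl⟩ := q.algebraMap_residueField_surjective y
    obtain ⟨r, hr⟩ := residue_surjective (ε e)
    refine ⟨residue R r, ?_⟩
    rw [ResidueField.map_residue]
    change _ = residue _ (algebraMap P.Ring (Localization.AtPrime q) e)
    rw [← sub_eq_zero, ← map_sub, residue_eq_zero_iff, IsScalarTower.algebraMap_apply R P.Ring,
      ← map_sub, hmem, map_sub, AlgHom.commutes, ← hr]
    exact sub_self _
  · have h : aeval (algebraMap P.Ring (Localization.AtPrime q) P.X) f = 0 := by
      rw [aeval_algebraMap_apply]
      exact (congrArg _ P.hasMap_X.1).trans (map_zero _)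
    exact h
  · rw [IsScalarTower.algebraMap_apply R P.Ring, ← map_sub, hmem, map_sub, AlgHom.commutes,
      P.lift_X]
    exact sub_self _

end PointedEtaleNeighborhood

/-! ### Maps out of the Henselization -/

namespace Henselization

open IsLocalRing

variable {R : Type u} [CommRing R] [IsLocalRing R]

lemma of_algebraMap (A : PointedEtaleNeighborhood R) (r : R) :
    of R A (algebraMap R A.carrier r) = algebraMap R (Henselization R) r := by
  let S := PointedEtaleNeighborhood.self R
  have h : S ≤ A := ⟨Algebra.ofId R A.carrier, A.isLocalHom⟩
  have := Ring.DirectLimit.of_f (G := fun A : PointedEtaleNeighborhood R => A.carrier)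
    (f := fun A B h => A.transition B h) h r
  refine Eq.trans ?_ this
  congr 1
  exact ((S.transition A h).commutes r).symm

/-- The existence part of the universal property of the Henselization, for Noetherian targets.
Compatibility of the maps on the neighborhoods with the transition maps comes from their
uniqueness. -/
theorem exists_ringHom_of_henselianLocalRing [IsNoetherianRing R]
    (H : Type*) [CommRing H] [HenselianLocalRing H] [IsNoetherianRing H] [Algebra R H]
    [IsLocalHom (algebraMap R H)] :
    ∃ φ : Henselization R →+* H, ∀ r, φ (algebraMap R (Henselization R) r) = algebraMap R H r := by
  let g (A : PointedEtaleNeighborhood R) : A.carrier →ₐ[R] H :=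
    (A.exists_algHom_of_henselianLocalRing H).some
  have hg (A B : PointedEtaleNeighborhood R) (h : A ≤ B) (x : A.carrier) :
      (g B).toRingHom (A.transition B h x) = (g A).toRingHom x :=
    DFunLike.congr_fun (A.algHom_ext_of_isNoetherianRing ((g B).comp (A.transition B h)) (g A)) x
  refine ⟨Ring.DirectLimit.lift (fun A : PointedEtaleNeighborhood R => A.carrier)
    (fun A B h => A.transition B h) H (fun A => (g A).toRingHom) hg, fun r => ?_⟩
  have h := Ring.DirectLimit.lift_of (G := fun A : PointedEtaleNeighborhood R => A.carrier)
    (f := fun A B h => A.transition B h) H (fun A => (g A).toRingHom) hg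
    (PointedEtaleNeighborhood.self R) r
  exact h.trans ((g (PointedEtaleNeighborhood.self R)).commutes r)

end Henselization

/-! ### Module structures over the Henselization -/

section CompatibleModules

open IsLocalRing

variable {R : Type u} [CommRing R] [IsLocalRing R] [IsNoetherianRing R]
  {M : Type v} [AddCommGroup M] [Module R M]

/-- The Henselization maps to the Henselian ring `R ⧸ Ann(M)`, which acts on `M`. -/
theorem HasCompatibleModuleStructure.of_henselianLocalRing [Nontrivial M]
    (h : HenselianLocalRing (R ⧸ Module.annihilator R M)) :
    HasCompatibleModuleStructure R (Henselization R) M := by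
  have : IsLocalHom (algebraMap R (R ⧸ Module.annihilator R M)) :=
    .of_surjective _ Ideal.Quotient.mk_surjective
  obtain ⟨φ, hφ⟩ :=
    Henselization.exists_ringHom_of_henselianLocalRing (R := R) (R ⧸ Module.annihilator R M)
  let := Module.quotientAnnihilator (R := R) (M := M)
  refine ⟨Module.compHom M φ, fun r x => ?_⟩
  change φ (algebraMap R (Henselization R) r) • x = r • x
  rw [hφ]
  rfl

/-- A pointed étale neighborhood `S` acting on a finite module acts through `R`: modulo the maximal
ideal of `R` the ring `S` is generated by `1`, and its image in `End_R(M)` is a finite module to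
which Nakayama's lemma applies. -/
lemma PointedEtaleNeighborhood.exists_smul_eq (A : PointedEtaleNeighborhood R) [Module.Finite R M]
    [Module A.carrier M] [IsScalarTower R A.carrier M] (s : A.carrier) :
    ∃ r : R, ∀ m : M, s • m = r • m := by
  let β : A.carrier →ₗ[R] Module.End R M := (Algebra.lsmul R R M).toLinearMap
  suffices h : LinearMap.range β ≤ Submodule.span R {1} by
    obtain ⟨r, hr⟩ := Submodule.mem_span_singleton.mp (h ⟨s, rfl⟩)
    exact ⟨r, fun m => (DFunLike.congr_fun hr m).symm⟩
  refine Submodule.le_of_le_smul_of_le_jacobson_bot (I := maximalIdeal R)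
    (IsNoetherian.noetherian _) (maximalIdeal_le_jacobson _) ?_
  rintro _ ⟨t, rfl⟩
  obtain ⟨r, hr⟩ := A.exists_algebraMap_sub_mem t
  rw [← Algebra.FormallyUnramified.map_maximalIdeal (R := R) (S := A.carrier)] at hr
  have ht : t = algebraMap R A.carrier r + (t - algebraMap R A.carrier r) := by ring
  rw [ht, map_add]
  refine Submodule.add_mem_sup ?_ ?_
  · refine Submodule.mem_span_singleton.mpr ⟨r, ?_⟩
    ext m
    simp [β]
  · rw [LinearMap.range_eq_map, ← Submodule.map_smul'', Ideal.smul_top_eq_map]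
    exact Submodule.mem_map_of_mem hr

/-- Some pointed étale neighborhood contains a root `x` of the given polynomial. On `M`, this root
acts as some `a` in `R`, and `a` is the required root modulo `Ann(M)`. -/
theorem HasCompatibleModuleStructure.henselModulo [Module.Finite R M] [Nontrivial M]
    (h : HasCompatibleModuleStructure R (Henselization R) M) :
    HenselModulo (Module.annihilator R M) := by
  obtain ⟨_, h⟩ := h
  intro f hf a₀ h₁ h₂
  obtain ⟨A, x, hx, hx₀⟩ := PointedEtaleNeighborhood.exists_root hf h₁ h₂
  let := Module.compHom M (Henselization.of R A)
  have hsmul (r : R) (m : M) : algebraMap R A.carrier r • m = r • m := by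
    change Henselization.of R A _ • m = _
    rw [Henselization.of_algebraMap, h]
  have := IsScalarTower.of_algebraMap_smul hsmul
  obtain ⟨a, ha⟩ := A.exists_smul_eq (M := M) x
  refine ⟨a, ?_, ?_⟩
  · rw [Module.mem_annihilator]
    intro m
    have hroot : algebraMap R A.carrier (f.eval a) • m = 0 := by
      have hdvd : x - algebraMap R A.carrier a ∣ algebraMap R A.carrier (f.eval a) := by
        rw [← aeval_algebraMap_apply_eq_algebraMap_eval, ← dvd_neg, ← zero_sub, ← hx,
          ← eval_map_algebraMap, ← eval_map_algebraMap]
        exact sub_dvd_eval_sub _ _ _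
      obtain ⟨c, hc⟩ := hdvd
      rw [hc, mul_comm, mul_smul, sub_smul, hsmul, ha, sub_self, smul_zero]
    rwa [hsmul] at hroot
  · by_contra hu
    -- Otherwise `x - a`, which annihilates `M`, would be a unit.
    have hu' : IsUnit (x - algebraMap R A.carrier a) := by
      rw [mem_maximalIdeal, mem_nonunits_iff, not_not] at hu
      have h := (hu.map (algebraMap R A.carrier)).neg
      refine (isUnit_iff_of_sub_mem ?_).mpr h
      convert hx₀ using 1
      rw [map_sub]
      ring
    obtain ⟨m, hm⟩ := exists_ne (0 : M)
    refine hm (hu'.smul_eq_zero.mp ?_)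
    rw [sub_smul, hsmul, ha, sub_self]

end CompatibleModules

theorem corollary1p14 (R : Type u) [CommRing R] [IsLocalRing R] [IsNoetherianRing R]
    (M : Type v) [AddCommGroup M] [Module R M] [Module.Finite R M] :
    List.TFAE
      [HasCompatibleModuleStructure R (Henselization R) M,
        ∀ P ∈ Module.support R M, HenselianLocalRing (R ⧸ P.asIdeal),
        ∀ P, Minimal (· ∈ Module.support R M) P → HenselianLocalRing (R ⧸ P.asIdeal)] ∧
    (Nontrivial M →
      (HasCompatibleModuleStructure R (Henselization R) M ↔
        HenselianLocalRing (R ⧸ Module.annihilator R M))) := by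
  rcases subsingleton_or_nontrivial M with hM | hM
  · -- For `M = 0` the support is empty and `M` is a module over any ring.
    have hsupp (P) : P ∉ Module.support R M := by simp [Module.support_eq_empty]
    have h₁ : HasCompatibleModuleStructure R (Henselization R) M :=
      ⟨{ smul := fun _ _ => 0
         one_smul := fun _ => Subsingleton.elim _ _
         mul_smul := fun _ _ _ => Subsingleton.elim _ _
         smul_zero := fun _ => Subsingleton.elim _ _
         smul_add := fun _ _ _ => Subsingleton.elim _ _
         add_smul := fun _ _ _ => Subsingleton.elim _ _
         zero_smul := fun _ => Subsingleton.elim _ _ }, fun _ _ => Subsingleton.elim _ _⟩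
    refine ⟨?_, fun hM' => (not_nontrivial M hM').elim⟩
    tfae_have 1 → 2 := fun _ P hP => (hsupp P hP).elim
    tfae_have 2 → 3 := fun _ P hP => (hsupp P hP.1).elim
    tfae_have 3 → 1 := fun _ => h₁
    tfae_finish
  · have hann : Module.annihilator R M ≤ IsLocalRing.maximalIdeal R := by
      refine IsLocalRing.le_maximalIdeal fun h => ?_
      exact not_subsingleton M (Module.annihilator_eq_top_iff.mp h)
    have hprime (P : PrimeSpectrum R) :
        HenselianLocalRing (R ⧸ P.asIdeal) ↔ HenselModulo P.asIdeal :=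
      henselianLocalRing_quotient_iff (IsLocalRing.le_maximalIdeal P.2.ne_top)
    have h14 : HasCompatibleModuleStructure R (Henselization R) M ↔
        HenselianLocalRing (R ⧸ Module.annihilator R M) :=
      ⟨fun h => (henselianLocalRing_quotient_iff hann).mpr h.henselModulo,
        .of_henselianLocalRing⟩
    refine ⟨?_, fun _ => h14⟩
    rw [h14, henselianLocalRing_quotient_iff hann]
    simp only [hprime]
    tfae_have 1 → 2 := fun h P hP => h.mono (Module.annihilator_le_of_mem_support hP)
    tfae_have 2 → 3 := fun h P hP => h P hP.1
    tfae_have 3 → 1 := by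
      intro h
      refine .of_minimalPrimes hann fun P hP => ?_
      refine h ⟨P, hP.1.1⟩ ⟨Module.mem_support_iff_of_finite.mpr hP.1.2, fun Q hQ hQP => ?_⟩
      exact hP.2 ⟨Q.2, Module.annihilator_le_of_mem_support hQ⟩ hQP
    tfae_finish
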